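/- Let $w\colon\mathbb{R}\to\mathbb{R}$ be a continuous function without zeros such that $1/w$ is integrable neither on $(-\infty,0)$ nor on $(0,\infty)$. Let $$L^2_{|w|}(\mathbb{R})=\Bigl\{x\colon\mathbb{R}\to\mathbb{C}\ \text{measurable}\;;\;\int_{\mathbb{R}}|w(\xi)|\,|x(\xi)|^2\,\mathrm{d}\xi<\infty\Bigr\}$$ (functions modulo equality almost everywhere), a Hilbert space with scalar product $\langle x,y\rangle=\int_{\mathbb{R}}\overline{x(\xi)}\,|w(\xi)|\,y(\xi)\,\mathrm{d}\xi$. Put $p_w(\xi)=\int_0^{\xi}w(\zeta)^{-1}\,\mathrm{d}\zeta$. Then $p_w\colon\mathbb{R}\to\mathbb{R}$ is bijective, so that $$\mu_w(\xi,t)=p_w^{-1}\bigl(p_w(\xi)+t\bigr)-\xi\qquad(\xi,t\in\mathbb{R})$$ is well defined. Let $A_w\colon D(A_w)\to L^2_{|w|}(\mathbb{R})$ be the operator $$A_wx=(wx)',\qquad D(A_w)=\bigl\{x\in L^2_{|w|}(\mathbb{R})\;;\;wx\in \mathrm{AC}_{\mathrm{loc}}(\mathbb{R})\text{ and }(wx)'\in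 L^2_{|w|}(\mathbb{R})\bigr\},$$ where $wx\in\mathrm{AC}_{\mathrm{loc}}(\mathbb{R})$ means that $wx$ agrees almost everywhere with a complex-valued function that is absolutely continuous on every compact interval, and $(wx)'$ is the almost everywhere derivative of that function. Then $A_w$ is the generator of a $C_0$-group $(T_w(t))_{t\in\mathbb{R}}$ of unitary operators on $L^2_{|w|}(\mathbb{R})$, that is, of a strongly continuous family with $T_w(0)=I$ and $T_w(s+t)=T_w(s)T_w(t)$ for all $s,t\in\mathbb{R}$, whose generator maps $x$ to $\lim_{t\to0}t^{-1}(T_w(t)x-x)$ on the domain of all $x$ for which this two-sided limit exists. The group is given by $$(T_w(t)x)(\xi)=\frac{w(\xi+\mu_w(\xi,t))}{w(\xi)}\,x(\xi+\mu_w(\xi,t))$$ for all $t\in\mathbb{R}$, all $x\in L^2_{|w|}(\mathbb{R})$ and almost every $\xi\in\mathbb{R}$. -/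

import Mathlib

open MeasureTheory Filter Topology
open scoped ENNReal

noncomputable section

namespace WeightedTransport

/-! ### Strongly continuous groups and their generators -/

section C0Group

variable {E : Type*} [NormedAddCommGroup E] [NormedSpace ℂ E]

/-- A family `(T t)` of bounded operators, indexed by all real `t`, is a `C₀`-group: it satisfies
`T 0 = 1` and the evolution property, and all its orbits are continuous. -/
structure IsC0Group (T : ℝ → E →L[ℂ] E) : Prop where
  map_zero : T 0 = 1
  map_add : ∀ s t : ℝ, T (s + t) = T s * T t
  continuous_orbit : ∀ x : E, Continuous fun t : ℝ => T t x

/-- The difference quotient `(T t x - x) / t`. -/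
def diffQuot (T : ℝ → E →L[ℂ] E) (x : E) (t : ℝ) : E := ((t⁻¹ : ℝ) : ℂ) • (T t x - x)

theorem diffQuot_add (T : ℝ → E →L[ℂ] E) (x y : E) :
    diffQuot T (x + y) = fun t => diffQuot T x t + diffQuot T y t := by
  funext t
  simp only [diffQuot, map_add, ← smul_add]
  congr 1
  abel

theorem diffQuot_smul (T : ℝ → E →L[ℂ] E) (c : ℂ) (x : E) :
    diffQuot T (c • x) = fun t => c • diffQuot T x t := by
  funext t
  simp only [diffQuot, map_smul, ← smul_sub]
  exact smul_comm _ _ _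

/-- The (infinitesimal) generator of a family `(T t)`: its domain consists of all `x` for which
`lim_{t → 0} (T t x - x) / t` exists (two-sided limit), and it maps `x` to this limit. -/
def generator (T : ℝ → E →L[ℂ] E) : E →ₗ.[ℂ] E where
  domain :=
    { carrier := {x | ∃ y, Tendsto (diffQuot T x) (𝓝[≠] 0) (𝓝 y)}
      zero_mem' := ⟨0, by
        have h : diffQuot T (0 : E) = fun _ => 0 := by
          funext t; simp [diffQuot]
        rw [h]; exact tendsto_const_nhds⟩
      add_mem' := by
        rintro x x' ⟨y, hy⟩ ⟨y', hy'⟩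
        exact ⟨y + y', by rw [diffQuot_add]; exact hy.add hy'⟩
      smul_mem' := by
        rintro c x ⟨y, hy⟩
        exact ⟨c • y, by rw [diffQuot_smul]; exact hy.const_smul c⟩ }
  toFun :=
    { toFun := fun x => Classical.choose x.2
      map_add' := fun x x' => by
        have h := Classical.choose_spec (x + x').2
        have h' := (Classical.choose_spec x.2).add (Classical.choose_spec x'.2)
        rw [← diffQuot_add] at h'
        exact tendsto_nhds_unique h h'
      map_smul' := fun c x => by
        have h := Classical.choose_spec (c • x).2
        have h' := (Classical.choose_spec x.2).const_smul c
        rw [← diffQuot_smul] at h'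
        exact tendsto_nhds_unique h h' }

end C0Group

/-! ### Weighted `L²`-spaces and locally absolutely continuous functions -/

/-- The measure `|w(ξ)| dξ` on the real line. -/
def weightMeasure (w : ℝ → ℝ) : Measure ℝ :=
  volume.withDensity fun ξ => ENNReal.ofReal |w ξ|

/-- The Hilbert space `L²_{|w|}(ℝ)` of complex-valued functions, with
`⟨x, y⟩ = ∫ conj (x ξ) * y ξ * |w ξ| dξ`. -/
abbrev WeightedL2 (w : ℝ → ℝ) : Type := Lp ℂ 2 (weightMeasure w)

/-- Locally absolutely continuous functions on the line: absolutely continuous on every compact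
interval. -/
def LocAC (z : ℝ → ℂ) : Prop := ∀ a b : ℝ, AbsolutelyContinuousOnInterval z a b

theorem LocAC.ae_differentiableAt {z : ℝ → ℂ} (hz : LocAC z) :
    ∀ᵐ ξ : ℝ, DifferentiableAt ℝ z ξ := by
  have h : ∀ᵐ ξ : ℝ, ∀ n : ℕ, ξ ∈ Set.uIcc (-(n : ℝ)) n → DifferentiableAt ℝ z ξ :=
    ae_all_iff.2 fun n => (hz (-(n : ℝ)) n).boundedVariationOn.ae_differentiableAt_of_mem_uIcc
  filter_upwards [h] with ξ hξ
  obtain ⟨n, hn⟩ := exists_nat_ge |ξ|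
  exact hξ n (Set.mem_uIcc.2 (Or.inl (abs_le.1 hn)))

theorem LocAC.continuous {z : ℝ → ℂ} (hz : LocAC z) : Continuous z := by
  refine continuous_iff_continuousAt.2 fun ξ => ?_
  refine (hz (ξ - 1) (ξ + 1)).continuousOn.continuousAt ?_
  rw [Set.uIcc_of_le (by linarith)]
  exact Icc_mem_nhds (by linarith) (by linarith)

theorem LocAC.add {z z' : ℝ → ℂ} (hz : LocAC z) (hz' : LocAC z') : LocAC (z + z') :=
  fun a b => (hz a b).add (hz' a b)

theorem LocAC.const_smul {z : ℝ → ℂ} (hz : LocAC z) (c : ℂ) : LocAC (c • z) :=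
  fun a b => (hz a b).const_smul c

theorem volume_ac_weightMeasure {w : ℝ → ℝ} (hw : Continuous w) (hw0 : ∀ ξ, w ξ ≠ 0) :
    volume ≪ weightMeasure w :=
  withDensity_absolutelyContinuous' (by fun_prop) (by simp [hw0])

theorem weightMeasure_ac_volume (w : ℝ → ℝ) : weightMeasure w ≪ volume :=
  withDensity_absolutelyContinuous _ _

/-- `z` is the locally absolutely continuous representative of `w x`, and its almost everywhere
derivative lies in `L²_{|w|}(ℝ)`. -/
structure IsACRep (w : ℝ → ℝ) (x : WeightedL2 w) (z : ℝ → ℂ) : Prop where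
  locAC : LocAC z
  ae_eq : ∀ᵐ ξ : ℝ, z ξ = (w ξ : ℂ) * x ξ
  memLp : MemLp (deriv z) 2 (weightMeasure w)

section Rep

variable {w : ℝ → ℝ} {x x' : WeightedL2 w} {z z' : ℝ → ℂ}

theorem IsACRep.unique (h : IsACRep w x z) (h' : IsACRep w x z') : z = z' := by
  refine (h.locAC.continuous.ae_eq_iff_eq volume h'.locAC.continuous).1 ?_
  filter_upwards [h.ae_eq, h'.ae_eq] with ξ h1 h2
  rw [h1, h2]

theorem deriv_add_ae (hz : LocAC z) (hz' : LocAC z') :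
    deriv (z + z') =ᵐ[weightMeasure w] deriv z + deriv z' := by
  refine (weightMeasure_ac_volume w).ae_le ?_
  filter_upwards [hz.ae_differentiableAt, hz'.ae_differentiableAt] with ξ h1 h2
  exact deriv_add h1 h2

theorem deriv_smul_ae (hz : LocAC z) (c : ℂ) :
    deriv (c • z) =ᵐ[weightMeasure w] c • deriv z := by
  refine (weightMeasure_ac_volume w).ae_le ?_
  filter_upwards [hz.ae_differentiableAt] with ξ h1
  exact deriv_const_smul c h1

theorem IsACRep.add (hw : Continuous w) (hw0 : ∀ ξ, w ξ ≠ 0)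
    (h : IsACRep w x z) (h' : IsACRep w x' z') : IsACRep w (x + x') (z + z') where
  locAC := h.locAC.add h'.locAC
  ae_eq := by
    filter_upwards [h.ae_eq, h'.ae_eq,
      (volume_ac_weightMeasure hw hw0).ae_le (Lp.coeFn_add x x')] with ξ h1 h2 h3
    rw [h3, Pi.add_apply, Pi.add_apply, h1, h2, mul_add]
  memLp := (h.memLp.add h'.memLp).ae_eq (deriv_add_ae h.locAC h'.locAC).symm

theorem IsACRep.smul (hw : Continuous w) (hw0 : ∀ ξ, w ξ ≠ 0) (c : ℂ)
    (h : IsACRep w x z) : IsACRep w (c • x) (c • z) where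
  locAC := h.locAC.const_smul c
  ae_eq := by
    filter_upwards [h.ae_eq,
      (volume_ac_weightMeasure hw hw0).ae_le (Lp.coeFn_smul c x)] with ξ h1 h3
    rw [h3, Pi.smul_apply, Pi.smul_apply, h1, smul_eq_mul, smul_eq_mul, mul_left_comm]
  memLp := (h.memLp.const_smul c).ae_eq (deriv_smul_ae h.locAC c).symm

theorem IsACRep.zero (hw : Continuous w) (hw0 : ∀ ξ, w ξ ≠ 0) :
    IsACRep w (0 : WeightedL2 w) (0 : ℝ → ℂ) where
  locAC := fun a b => by
    rw [absolutelyContinuousOnInterval_iff]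
    intro ε hε
    exact ⟨1, one_pos, fun E _ _ => by simpa using hε⟩
  ae_eq := by
    filter_upwards [(volume_ac_weightMeasure hw hw0).ae_le
      (Lp.coeFn_zero ℂ 2 (weightMeasure w))] with ξ h
    rw [h]; simp
  memLp := by
    have h : deriv (0 : ℝ → ℂ) = 0 := by funext ξ; simp
    rw [h]; exact MemLp.zero

end Rep

/-- The weighted transport operator `A_w x = (w x)'` in `L²_{|w|}(ℝ)` on its maximal domain: the
domain consists of all `x` such that `w x` is locally absolutely continuous (as a class of
functions modulo null sets: has a representative that is) with
`(w x)'` (derivative almost everywhere) in `L²_{|w|}(ℝ)`. -/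
def transportOp (w : ℝ → ℝ) (hw : Continuous w) (hw0 : ∀ ξ, w ξ ≠ 0) :
    WeightedL2 w →ₗ.[ℂ] WeightedL2 w where
  domain :=
    { carrier := {x | ∃ z : ℝ → ℂ, IsACRep w x z}
      zero_mem' := ⟨0, IsACRep.zero hw hw0⟩
      add_mem' := by
        rintro x x' ⟨z, hz⟩ ⟨z', hz'⟩
        exact ⟨z + z', hz.add hw hw0 hz'⟩
      smul_mem' := by
        rintro c x ⟨z, hz⟩
        exact ⟨c • z, hz.smul hw hw0 c⟩ }
  toFun :=
    { toFun := fun x => (Classical.choose_spec x.2).memLp.toLp (deriv (Classical.choose x.2))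
      map_add' := fun x x' => by
        have h := Classical.choose_spec x.2
        have h' := Classical.choose_spec x'.2
        rw [← MemLp.toLp_add h.memLp h'.memLp]
        refine MemLp.toLp_congr _ _ ?_
        rw [(Classical.choose_spec (x + x').2).unique (h.add hw hw0 h')]
        exact deriv_add_ae h.locAC h'.locAC
      map_smul' := fun c x => by
        have h := Classical.choose_spec x.2
        rw [RingHom.id_apply, ← MemLp.toLp_const_smul c h.memLp]
        refine MemLp.toLp_congr _ _ ?_
        rw [(Classical.choose_spec (c • x).2).unique (h.smul hw hw0 c)]
        exact deriv_smul_ae h.locAC c }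

/-! ### The flow -/

/-- `p_w(ξ) = ∫₀^ξ w(ζ)⁻¹ dζ`. -/
def pFun (w : ℝ → ℝ) (ξ : ℝ) : ℝ := ∫ ζ in (0 : ℝ)..ξ, (w ζ)⁻¹

/-- `μ_w(ξ, t) = p_w⁻¹(p_w(ξ) + t) - ξ`; here `Function.invFun (pFun w)` is the inverse function of
`p_w` whenever `p_w` is bijective. -/
def muFun (w : ℝ → ℝ) (ξ t : ℝ) : ℝ := Function.invFun (pFun w) (pFun w ξ + t) - ξ

end WeightedTransport

end

noncomputable section

namespace WeightedTransport

/-! ### Locally absolutely continuous functions and primitives -/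

/-! Substituting s = p_w(ξ) straightens the flow to translation. A continuous w without zeros has
constant sign, so p_w is strictly monotone, and the two non-integrability hypotheses make it onto ℝ
(`exists_homeomorph`). Since p_w' = 1/w, the map (Uy)(ξ) = w(ξ)⁻¹ y(p_w(ξ)) is unitary from L²(ℝ) to
L²_{|w|}(ℝ) (`transformEquiv`), and the group sought is T(t) = U S(t) U⁻¹ with S the translation
group. The group laws, unitarity and the explicit formula carry over from S.

The generators are compared as graphs. For x = Uy and v = Uu one has wx = y ∘ p_w and ∫₀^ξ v =
∫₀^{p_w(ξ)} u, so (x, v) lies in the graph of A_w exactly when y = c + ∫₀ u almost everywhere for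
some constant c (`mem_graph_transportOp_transformEquiv_iff`). The same condition describes the
generator of S (`ae_eq_primitive_of_tendsto`, `tendsto_of_ae_eq_primitive`). -/

theorem absolutelyContinuousOnInterval_of_dist_le {X Y : Type*} [PseudoMetricSpace X]
    [PseudoMetricSpace Y] {f : ℝ → X} {g : ℝ → Y} {a b : ℝ}
    (hg : AbsolutelyContinuousOnInterval g a b)
    (h : ∀ x y, dist (f x) (f y) ≤ dist (g x) (g y)) : AbsolutelyContinuousOnInterval f a b := by
  rw [absolutelyContinuousOnInterval_iff] at hg ⊢
  intro ε hε
  obtain ⟨δ, hδ, H⟩ := hg ε hε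
  exact ⟨δ, hδ, fun E hE hEδ => (Finset.sum_le_sum fun i _ => h _ _).trans_lt (H E hE hEδ)⟩

theorem _root_.MeasureTheory.LocallyIntegrable.intervalIntegrable_interval {E : Type*}
    [NormedAddCommGroup E] {u : ℝ → E} (hu : LocallyIntegrable u) (a b : ℝ) :
    IntervalIntegrable u volume a b :=
  intervalIntegrable_iff.2
    ((hu.integrableOn_isCompact isCompact_uIcc).mono_set Set.uIoc_subset_uIcc)

theorem LocAC.primitive {u : ℝ → ℂ} (hu : LocallyIntegrable u) (c : ℂ) :
    LocAC fun s => c + ∫ r in (0 : ℝ)..s, u r := by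
  intro a b
  have hi (a b : ℝ) : IntervalIntegrable u volume a b := hu.intervalIntegrable_interval a b
  have hn (a b : ℝ) : IntervalIntegrable (fun r => ‖u r‖) volume a b := (hi a b).norm
  have hac : AbsolutelyContinuousOnInterval (fun s => ∫ r in a..s, ‖u r‖) a b :=
    (hn a b).absolutelyContinuousOnInterval_intervalIntegral Set.left_mem_uIcc
  -- Increments of the primitive of u are dominated by those of the primitive of ‖u‖.
  refine absolutelyContinuousOnInterval_of_dist_le hac fun x y => ?_
  rw [dist_eq_norm, dist_eq_norm, add_sub_add_left_eq_sub,
    intervalIntegral.integral_interval_sub_left (hi _ _) (hi _ _),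
    intervalIntegral.integral_interval_sub_left (hn _ _) (hn _ _), Real.norm_eq_abs]
  exact intervalIntegral.norm_integral_le_abs_integral_norm

theorem deriv_primitive_ae {u : ℝ → ℂ} (hu : LocallyIntegrable u) (c : ℂ) :
    ∀ᵐ s, deriv (fun s => c + ∫ r in (0 : ℝ)..s, u r) s = u s := by
  filter_upwards [_root_.LocallyIntegrable.ae_hasDerivAt_integral hu] with s hs
  exact ((hs 0).const_add c).deriv

theorem LocAC.eq_add_integral {z v : ℝ → ℂ} (hz : LocAC z) (hv : LocallyIntegrable v)
    (h : ∀ᵐ s, deriv z s = v s) (s : ℝ) : z s = z 0 + ∫ r in (0 : ℝ)..s, v r := by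
  -- An absolutely continuous function with derivative zero almost everywhere is constant; this is
  -- applied to z minus the primitive of v.
  have hg : LocAC (z + (-1 : ℂ) • fun s => (0 : ℂ) + ∫ r in (0 : ℝ)..s, v r) :=
    hz.add ((LocAC.primitive hv 0).const_smul _)
  have h0 : ∀ᵐ s, HasDerivAt (z + (-1 : ℂ) • fun s => (0 : ℂ) + ∫ r in (0 : ℝ)..s, v r) 0 s := by
    filter_upwards [hz.ae_differentiableAt, h,
      _root_.LocallyIntegrable.ae_hasDerivAt_integral hv] with s h1 h2 h3
    have := h1.hasDerivAt.add (((h3 0).const_add 0).const_smul (-1 : ℂ))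
    rw [h2] at this
    simpa using this
  obtain ⟨C, hC⟩ := (hg 0 s).const_of_ae_hasDerivAt_zero (h0.mono fun x hx _ => hx)
  have e1 := hC 0 Set.left_mem_uIcc
  have e2 := hC s Set.right_mem_uIcc
  simp only [Pi.add_apply, Pi.smul_apply, zero_add, smul_eq_mul,
    intervalIntegral.integral_same] at e1 e2
  linear_combination e2 - e1

/-! ### Interval integrals on `L²(ℝ)` -/

theorem locallyIntegrable_coe (f : Lp ℂ 2 (volume : Measure ℝ)) : LocallyIntegrable f :=
  (Lp.memLp f).locallyIntegrable one_le_two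

/-- The functional `f ↦ ∫ₐᵇ f` on `L²(ℝ)`. -/
def intervalCLM (a b : ℝ) : Lp ℂ 2 (volume : Measure ℝ) →L[ℂ] ℂ :=
  innerSL ℂ (indicatorConstLp 2 (measurableSet_Ioc (a := a) (b := b)) (by simp) (1 : ℂ)) -
    innerSL ℂ (indicatorConstLp 2 (measurableSet_Ioc (a := b) (b := a)) (by simp) (1 : ℂ))

theorem intervalCLM_apply (a b : ℝ) (f : Lp ℂ 2 (volume : Measure ℝ)) :
    intervalCLM a b f = ∫ s in a..b, f s := by
  simp only [intervalCLM, sub_apply, innerSL_apply_apply,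
    L2.inner_indicatorConstLp_one, intervalIntegral]

/-- By Lebesgue differentiation, f and g are recovered almost everywhere from their primitives.
Identities in L²(ℝ) can thus be tested on intervals. -/
theorem eq_of_intervalCLM_eq {f g : Lp ℂ 2 (volume : Measure ℝ)}
    (h : ∀ a b, intervalCLM a b f = intervalCLM a b g) : f = g := by
  refine Lp.ext ?_
  filter_upwards [_root_.LocallyIntegrable.ae_hasDerivAt_integral (locallyIntegrable_coe f),
    _root_.LocallyIntegrable.ae_hasDerivAt_integral (locallyIntegrable_coe g)] with s hf hg
  have e : (fun x => ∫ r in (0 : ℝ)..x, f r) = fun x => ∫ r in (0 : ℝ)..x, g r := by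
    funext x
    rw [← intervalCLM_apply, ← intervalCLM_apply, h]
  have := hf 0
  rw [e] at this
  exact this.unique (hg 0)

/-! ### The translation group on `L²(ℝ)` -/

/-- Translation `(S t f)(s) = f (s + t)` on `L²(ℝ)`. -/
def translation (t : ℝ) :
    Lp ℂ 2 (volume : Measure ℝ) →ₗᵢ[ℂ] Lp ℂ 2 (volume : Measure ℝ) :=
  Lp.compMeasurePreservingₗᵢ ℂ (fun s => s + t) (measurePreserving_add_right volume t)

theorem translation_apply_ae (t : ℝ) (f : Lp ℂ 2 (volume : Measure ℝ)) :
    ∀ᵐ s, translation t f s = f (s + t) :=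
  Lp.coeFn_compMeasurePreserving f (measurePreserving_add_right volume t)

theorem ae_add_right {P : ℝ → Prop} (h : ∀ᵐ s, P s) (t : ℝ) : ∀ᵐ s, P (s + t) :=
  (measurePreserving_add_right volume t).quasiMeasurePreserving.ae h

theorem translation_zero (f : Lp ℂ 2 (volume : Measure ℝ)) : translation 0 f = f := by
  refine Lp.ext ?_
  filter_upwards [translation_apply_ae 0 f] with s hs
  rw [hs, add_zero]

theorem translation_add (r t : ℝ) (f : Lp ℂ 2 (volume : Measure ℝ)) :
    translation (r + t) f = translation r (translation t f) := by
  refine Lp.ext ?_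
  filter_upwards [translation_apply_ae (r + t) f, translation_apply_ae r (translation t f),
    ae_add_right (translation_apply_ae t f) r] with s h1 h2 h3
  rw [h1, h2, h3, add_assoc]

theorem continuous_translation (f : Lp ℂ 2 (volume : Measure ℝ)) :
    Continuous fun t => translation t f := by
  -- Currying makes t ↦ (s ↦ s + t) continuous for the compact-open topology, which suffices for
  -- composition with measure-preserving maps to be continuous in L².
  let g : C(ℝ, C(ℝ, ℝ)) := (ContinuousMap.mk (fun a : ℝ × ℝ => a.2 + a.1) (by fun_prop)).curry
  exact (continuous_const (y := f)).compMeasurePreservingLp g.continuous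
    (fun t => measurePreserving_add_right volume t) (by simp)

/-- Translation as a unitary equivalence of `L²(ℝ)`. -/
def translationEquiv (t : ℝ) :
    Lp ℂ 2 (volume : Measure ℝ) ≃ₗᵢ[ℂ] Lp ℂ 2 (volume : Measure ℝ) :=
  LinearIsometryEquiv.ofSurjective (translation t) fun f =>
    ⟨translation (-t) f, by rw [← translation_add, add_neg_cancel, translation_zero]⟩

theorem intervalCLM_translation (a b t : ℝ) (f : Lp ℂ 2 (volume : Measure ℝ)) :
    intervalCLM a b (translation t f) = ∫ s in (a + t)..(b + t), f s := by
  rw [intervalCLM_apply, ← intervalIntegral.integral_comp_add_right]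
  exact intervalIntegral.integral_congr_ae
    ((translation_apply_ae t f).mono fun s hs _ => hs)

theorem integral_translate_sub {z : ℝ → ℂ} (hz : LocallyIntegrable z) (a b t : ℝ) :
    (∫ s in (a + t)..(b + t), z s) - ∫ s in a..b, z s =
      ((∫ s in (0 : ℝ)..(b + t), z s) - ∫ s in (0 : ℝ)..b, z s) -
        ((∫ s in (0 : ℝ)..(a + t), z s) - ∫ s in (0 : ℝ)..a, z s) := by
  have hi (a b : ℝ) : IntervalIntegrable z volume a b := hz.intervalIntegrable_interval a b
  rw [← intervalIntegral.integral_interval_sub_left (hi 0 (b + t)) (hi 0 (a + t)),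
    ← intervalIntegral.integral_interval_sub_left (hi 0 b) (hi 0 a)]
  ring

/-- Integrated over [a, b], the difference quotients tend to ∫ₐᵇ u by continuity of the functional,
and to y(b) - y(a) when a and b are Lebesgue points of y. Fixing one such a determines the constant.
-/
theorem ae_eq_primitive_of_tendsto {y u : Lp ℂ 2 (volume : Measure ℝ)}
    (h : Tendsto (fun t : ℝ => ((t⁻¹ : ℝ) : ℂ) • (translation t y - y)) (𝓝[≠] 0) (𝓝 u)) :
    ∃ c : ℂ, ∀ᵐ s, y s = c + ∫ r in (0 : ℝ)..s, u r := by
  have hd := _root_.LocallyIntegrable.ae_hasDerivAt_integral (locallyIntegrable_coe y)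
  have hi (a b : ℝ) : IntervalIntegrable u volume a b :=
    (locallyIntegrable_coe u).intervalIntegrable_interval a b
  have hsl : ∀ a, (∀ c : ℝ, HasDerivAt (fun x => ∫ r in c..x, y r) (y a) a) →
      Tendsto (fun t : ℝ => ((t⁻¹ : ℝ) : ℂ) *
        ((∫ r in (0 : ℝ)..(a + t), y r) - ∫ r in (0 : ℝ)..a, y r)) (𝓝[≠] 0) (𝓝 (y a)) := by
    intro a ha
    have := (hasDerivAt_iff_tendsto_slope_zero.1 (ha 0))
    refine this.congr fun t => ?_
    rw [Complex.real_smul]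
  obtain ⟨a, ha⟩ := hd.exists
  refine ⟨y a - ∫ r in (0 : ℝ)..a, u r, ?_⟩
  filter_upwards [hd] with b hb
  have h1 := ((intervalCLM a b).continuous.tendsto u).comp h
  have h2 := (hsl b hb).sub (hsl a ha)
  have h3 : intervalCLM a b u = y b - y a := by
    refine tendsto_nhds_unique (h1.congr fun t => ?_) h2
    rw [Function.comp_apply, map_smul, map_sub, intervalCLM_translation, intervalCLM_apply,
      integral_translate_sub (locallyIntegrable_coe y), smul_eq_mul, mul_sub]
  rw [intervalCLM_apply, ← intervalIntegral.integral_interval_sub_left (hi 0 b) (hi 0 a)] at h3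
  linear_combination -h3

/-- Tested on [a, b], the right side becomes the integral of z(r + b) - z(r + a) over r from 0 to t,
with z the primitive representing y; regrouping the integrals of z gives the left side. -/
theorem translation_sub_eq_integral {y u : Lp ℂ 2 (volume : Measure ℝ)} {c : ℂ}
    (h : ∀ᵐ s, y s = c + ∫ r in (0 : ℝ)..s, u r) (t : ℝ) :
    translation t y - y = ∫ r in (0 : ℝ)..t, translation r u := by
  set z : ℝ → ℂ := fun s => c + ∫ r in (0 : ℝ)..s, u r with hzdef
  have hz : Continuous z := (LocAC.primitive (locallyIntegrable_coe u) c).continuous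
  have hzi (a b : ℝ) : IntervalIntegrable z volume a b := hz.intervalIntegrable a b
  have hi (a b : ℝ) : IntervalIntegrable u volume a b :=
    (locallyIntegrable_coe u).intervalIntegrable_interval a b
  have hyz (a b : ℝ) : ∫ s in a..b, y s = ∫ s in a..b, z s :=
    intervalIntegral.integral_congr_ae (h.mono fun s hs _ => hs)
  refine eq_of_intervalCLM_eq fun a b => ?_
  rw [← ContinuousLinearMap.intervalIntegral_comp_comm _
    ((continuous_translation u).intervalIntegrable 0 t), map_sub, intervalCLM_translation,
    intervalCLM_apply, hyz, hyz]
  have e : ∀ r, intervalCLM a b (translation r u) = z (r + b) - z (r + a) := by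
    intro r
    rw [intervalCLM_translation, ← intervalIntegral.integral_interval_sub_left
      (hi 0 (b + r)) (hi 0 (a + r)), hzdef]
    simp only [add_comm r]
    ring
  simp only [e]
  have hc (d : ℝ) : Continuous fun r => z (r + d) := by fun_prop
  rw [intervalIntegral.integral_sub ((hc b).intervalIntegrable _ _)
    ((hc a).intervalIntegrable _ _),
    intervalIntegral.integral_comp_add_right, intervalIntegral.integral_comp_add_right,
    integral_translate_sub hz.locallyIntegrable, zero_add, zero_add, add_comm t, add_comm t,
    intervalIntegral.integral_interval_sub_left (hzi _ _) (hzi _ _),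
    intervalIntegral.integral_interval_sub_left (hzi _ _) (hzi _ _)]

theorem tendsto_of_ae_eq_primitive {y u : Lp ℂ 2 (volume : Measure ℝ)} {c : ℂ}
    (h : ∀ᵐ s, y s = c + ∫ r in (0 : ℝ)..s, u r) :
    Tendsto (fun t : ℝ => ((t⁻¹ : ℝ) : ℂ) • (translation t y - y)) (𝓝[≠] 0) (𝓝 u) := by
  -- The orbit of u is continuous, so its L²-valued integral has derivative u at 0.
  have hd := ((continuous_translation u).integral_hasStrictDerivAt 0 0).hasDerivAt
  rw [translation_zero, hasDerivAt_iff_tendsto_slope_zero] at hd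
  refine hd.congr fun t => ?_
  rw [zero_add, intervalIntegral.integral_same, sub_zero, ← translation_sub_eq_integral h]
  exact (Complex.coe_smul _ _).symm

/-! ### The homeomorphism `p_w` -/

section PFun

variable {w : ℝ → ℝ}

theorem pFun_neg (w : ℝ → ℝ) (ξ : ℝ) : pFun (fun ζ => -w ζ) ξ = -pFun w ξ := by
  simp [pFun, inv_neg, intervalIntegral.integral_neg]

theorem hasDerivAt_pFun (hw : Continuous w) (hw0 : ∀ ξ, w ξ ≠ 0) (ξ : ℝ) :
    HasDerivAt (pFun w) (w ξ)⁻¹ ξ :=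
  ((hw.inv₀ hw0).integral_hasStrictDerivAt 0 ξ).hasDerivAt

theorem continuous_pFun (hw : Continuous w) (hw0 : ∀ ξ, w ξ ≠ 0) : Continuous (pFun w) :=
  continuous_iff_continuousAt.2 fun ξ => (hasDerivAt_pFun hw hw0 ξ).continuousAt

theorem pos_or_neg (hw : Continuous w) (hw0 : ∀ ξ, w ξ ≠ 0) :
    (∀ ξ, 0 < w ξ) ∨ ∀ ξ, w ξ < 0 := by
  by_contra! h
  obtain ⟨⟨a, ha⟩, b, hb⟩ := h
  obtain ⟨c, hc⟩ := mem_range_of_exists_le_of_exists_ge hw ⟨a, ha⟩ ⟨b, hb⟩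
  exact hw0 c hc

theorem strictMono_pFun (hw : Continuous w) (hpos : ∀ ξ, 0 < w ξ) : StrictMono (pFun w) :=
  strictMono_of_hasDerivAt_pos (fun ξ => hasDerivAt_pFun hw (fun ξ => (hpos ξ).ne') ξ)
    fun ξ => inv_pos.2 (hpos ξ)

theorem surjective_pFun (hw : Continuous w) (hpos : ∀ ξ, 0 < w ξ)
    (hneg : ¬ IntegrableOn (fun ξ => (w ξ)⁻¹) (Set.Iio 0))
    (hpos' : ¬ IntegrableOn (fun ξ => (w ξ)⁻¹) (Set.Ioi 0)) : Function.Surjective (pFun w) := by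
  have hw0 : ∀ ξ, w ξ ≠ 0 := fun ξ => (hpos ξ).ne'
  have hc : Continuous fun ξ => (w ξ)⁻¹ := hw.inv₀ hw0
  have hn : ∀ ξ, ‖(w ξ)⁻¹‖ = (w ξ)⁻¹ := fun ξ =>
    Real.norm_of_nonneg (inv_nonneg.2 (hpos ξ).le)
  intro y
  refine mem_range_of_exists_le_of_exists_ge (continuous_pFun hw hw0) ?_ ?_
  -- If p_w stayed above y, the integrals of 1/w over [i, 0] would be bounded by -y, making 1/w
  -- integrable on the negative half-line.
  · by_contra! h
    refine hneg (IntegrableOn.mono_set ?_ Set.Iio_subset_Iic_self)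
    refine integrableOn_Iic_of_intervalIntegral_norm_bounded (-y) 0
      (fun i : ℝ => (hc.integrableOn_Icc).mono_set Set.Ioc_subset_Icc_self) tendsto_id
      (Eventually.of_forall fun i => ?_)
    simp only [hn, id]
    rw [intervalIntegral.integral_symm]
    exact neg_le_neg (h i).le
  · by_contra! h
    refine hpos' (integrableOn_Ioi_of_intervalIntegral_norm_bounded y 0
      (fun i : ℝ => (hc.integrableOn_Icc).mono_set Set.Ioc_subset_Icc_self) tendsto_id
      (Eventually.of_forall fun i => ?_))
    simp only [hn, id]
    exact (h i).le

theorem exists_homeomorph_of_pos (hw : Continuous w) (hpos : ∀ ξ, 0 < w ξ)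
    (hneg : ¬ IntegrableOn (fun ξ => (w ξ)⁻¹) (Set.Iio 0))
    (hpos' : ¬ IntegrableOn (fun ξ => (w ξ)⁻¹) (Set.Ioi 0)) : ∃ e : ℝ ≃ₜ ℝ, ⇑e = pFun w :=
  ⟨((strictMono_pFun hw hpos).orderIsoOfSurjective _
    (surjective_pFun hw hpos hneg hpos')).toHomeomorph, rfl⟩

theorem exists_homeomorph (hw : Continuous w) (hw0 : ∀ ξ, w ξ ≠ 0)
    (hneg : ¬ IntegrableOn (fun ξ => (w ξ)⁻¹) (Set.Iio 0))
    (hpos : ¬ IntegrableOn (fun ξ => (w ξ)⁻¹) (Set.Ioi 0)) : ∃ e : ℝ ≃ₜ ℝ, ⇑e = pFun w := by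
  rcases pos_or_neg hw hw0 with h | h
  · exact exists_homeomorph_of_pos hw h hneg hpos
  · have key : ∀ s : Set ℝ, IntegrableOn (fun ξ => (-w ξ)⁻¹) s ↔
        IntegrableOn (fun ξ => (w ξ)⁻¹) s := by
      intro s
      simp only [inv_neg]
      exact integrable_neg_iff
    obtain ⟨e, he⟩ := exists_homeomorph_of_pos (w := fun ξ => -w ξ) hw.neg
      (fun ξ => neg_pos.2 (h ξ)) (by rwa [key]) (by rwa [key])
    refine ⟨e.trans (Homeomorph.neg ℝ), funext fun ξ => ?_⟩
    rw [Homeomorph.trans_apply, he, pFun_neg, Homeomorph.coe_neg, neg_neg]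

theorem integral_comp_pFun (hw : Continuous w) (hw0 : ∀ ξ, w ξ ≠ 0) (g : ℝ → ℂ) (ξ : ℝ) :
    ∫ ζ in (0 : ℝ)..ξ, ((w ζ : ℂ))⁻¹ * g (pFun w ζ) = ∫ s in (0 : ℝ)..pFun w ξ, g s := by
  have h0 : pFun w 0 = 0 := intervalIntegral.integral_same
  have hd := hasDerivAt_pFun hw hw0
  have hc := continuous_pFun hw hw0
  have e : ∀ ζ, ((w ζ : ℂ))⁻¹ * g (pFun w ζ) = (w ζ)⁻¹ • (g ∘ pFun w) ζ := fun ζ => by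
    rw [Complex.real_smul, Complex.ofReal_inv, Function.comp_apply]
  simp only [e]
  conv_rhs => rw [← h0]
  rcases pos_or_neg hw hw0 with h | h
  · exact intervalIntegral.integral_deriv_smul_comp_of_deriv_nonneg hc.continuousOn
      (fun ζ _ => hd ζ) fun ζ _ => inv_nonneg.2 (h ζ).le
  · exact intervalIntegral.integral_deriv_smul_comp_of_deriv_nonpos hc.continuousOn
      (fun ζ _ => hd ζ) fun ζ _ => inv_nonpos.2 (h ζ).le

end PFun

/-! ### Change of variables between `L²(ℝ)` and `L²_{|w|}(ℝ)` -/

section Transform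

variable {w : ℝ → ℝ}

theorem ae_weightMeasure_iff (hw : Continuous w) (hw0 : ∀ ξ, w ξ ≠ 0) {P : ℝ → Prop} :
    (∀ᵐ ξ ∂weightMeasure w, P ξ) ↔ ∀ᵐ ξ, P ξ :=
  ⟨fun h => (volume_ac_weightMeasure hw hw0).ae_le h, fun h => (weightMeasure_ac_volume w).ae_le h⟩

theorem measurePreserving_pFun (hw : Continuous w) (hw0 : ∀ ξ, w ξ ≠ 0) {e : ℝ ≃ₜ ℝ}
    (he : ⇑e = pFun w) :
    MeasurePreserving e (weightMeasure fun ξ => (w ξ)⁻¹) volume := by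
  refine ⟨e.continuous.measurable, ?_⟩
  have h := map_withDensity_abs_det_fderiv_eq_addHaar (volume : Measure ℝ)
    MeasurableSet.univ.nullMeasurableSet
    (fun x _ => (hasDerivAt_pFun hw hw0 x).hasFDerivAt.hasFDerivWithinAt)
    (he ▸ e.injective.injOn)
  rw [← he, Set.image_univ, e.surjective.range_eq, Measure.restrict_univ] at h
  simpa [weightMeasure] using h

/-- The measure |1/w| dξ, whose image under p_w is Lebesgue measure, has the same null sets as
Lebesgue measure. -/
theorem ae_comp_iff (hw : Continuous w) (hw0 : ∀ ξ, w ξ ≠ 0) {e : ℝ ≃ₜ ℝ}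
    (he : ⇑e = pFun w) {P : ℝ → Prop} : (∀ᵐ ξ, P (e ξ)) ↔ ∀ᵐ s, P s := by
  have hp := measurePreserving_pFun hw hw0 he
  have hi := ae_weightMeasure_iff (hw.inv₀ hw0) (fun ξ => inv_ne_zero (hw0 ξ))
    (P := fun ξ => P (e ξ))
  constructor
  · intro h
    have := (hp.symm e.toMeasurableEquiv).quasiMeasurePreserving.ae (hi.2 h)
    filter_upwards [this] with s hs
    simpa using hs
  · intro h
    exact hi.1 (hp.quasiMeasurePreserving.ae h)

/-- The weights combine as |w| |w⁻¹|² = |w⁻¹|, the Jacobian of p_w. -/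
theorem eLpNorm_transform (hw : Continuous w) (hw0 : ∀ ξ, w ξ ≠ 0) {e : ℝ ≃ₜ ℝ}
    (he : ⇑e = pFun w) (g : ℝ → ℂ) :
    eLpNorm (fun ξ => ((w ξ : ℂ))⁻¹ * g (e ξ)) 2 (weightMeasure w) = eLpNorm g 2 volume := by
  have hp := measurePreserving_pFun hw hw0 he
  have h1 : eLpNorm g 2 volume = eLpNorm (g ∘ e) 2 (weightMeasure fun ξ => (w ξ)⁻¹) := by
    rw [← hp.map_eq, e.measurableEmbedding.eLpNorm_map_measure]
  rw [h1, eLpNorm_eq_lintegral_rpow_enorm_toReal two_ne_zero ENNReal.ofNat_ne_top,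
    eLpNorm_eq_lintegral_rpow_enorm_toReal two_ne_zero ENNReal.ofNat_ne_top]
  congr 1
  have hm : Measurable fun ξ => ENNReal.ofReal |w ξ| := by fun_prop
  have hm' : Measurable fun ξ => ENNReal.ofReal |(w ξ)⁻¹| := by fun_prop
  rw [weightMeasure, weightMeasure,
    lintegral_withDensity_eq_lintegral_mul_non_measurable _ hm (by simp),
    lintegral_withDensity_eq_lintegral_mul_non_measurable _ hm' (by simp)]
  refine lintegral_congr fun ξ => ?_
  have e1 : ‖((w ξ : ℂ))⁻¹‖ₑ = ENNReal.ofReal |(w ξ)⁻¹| := by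
    rw [← Complex.ofReal_inv, ← ofReal_norm, Complex.norm_real, Real.norm_eq_abs]
  have e2 : ENNReal.ofReal |w ξ| * ENNReal.ofReal |(w ξ)⁻¹| = 1 := by
    rw [← ENNReal.ofReal_mul (abs_nonneg _), ← abs_mul, mul_inv_cancel₀ (hw0 ξ)]; simp
  simp only [Pi.mul_apply, Function.comp_apply, ENNReal.toReal_ofNat, ENNReal.rpow_ofNat,
    enorm_mul, e1]
  calc _ = (ENNReal.ofReal |w ξ| * ENNReal.ofReal |(w ξ)⁻¹|) *
        (ENNReal.ofReal |(w ξ)⁻¹| * ‖g (e ξ)‖ₑ ^ 2) := by ring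
    _ = _ := by rw [e2, one_mul]

theorem memLp_transform_iff (hw : Continuous w) (hw0 : ∀ ξ, w ξ ≠ 0) {e : ℝ ≃ₜ ℝ}
    (he : ⇑e = pFun w) (g : ℝ → ℂ) :
    MemLp (fun ξ => ((w ξ : ℂ))⁻¹ * g (e ξ)) 2 (weightMeasure w) ↔ MemLp g 2 volume := by
  have hp := measurePreserving_pFun hw hw0 he
  have hwc : Continuous fun ξ => (w ξ : ℂ) := by fun_prop
  have hwi : Continuous fun ξ => ((w ξ : ℂ))⁻¹ := hwc.inv₀ (by simpa using hw0)
  have hw0' : ∀ ξ, (w ξ)⁻¹ ≠ 0 := fun ξ => inv_ne_zero (hw0 ξ)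
  rw [MemLp, MemLp, eLpNorm_transform hw hw0 he,
    ← hp.aestronglyMeasurable_comp_iff e.measurableEmbedding]
  refine and_congr_left fun _ => ⟨fun h => ?_, fun h => ?_⟩
  · have h' := (h.mono_ac ((weightMeasure_ac_volume fun ξ => (w ξ)⁻¹).trans
      (volume_ac_weightMeasure hw hw0)))
    refine (hwc.aestronglyMeasurable.mul h').congr (Eventually.of_forall fun ξ => ?_)
    have : (w ξ : ℂ) ≠ 0 := by simpa using hw0 ξ
    simp [mul_inv_cancel_left₀ this]
  · have h' := (h.mono_ac ((weightMeasure_ac_volume w).trans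
      (volume_ac_weightMeasure (hw.inv₀ hw0) hw0')))
    exact hwi.aestronglyMeasurable.mul h'

/-- The isometry `L²(ℝ) → L²_{|w|}(ℝ)` mapping `y` to `ξ ↦ w(ξ)⁻¹ y(p_w(ξ))`. -/
def transform (hw : Continuous w) (hw0 : ∀ ξ, w ξ ≠ 0) {e : ℝ ≃ₜ ℝ} (he : ⇑e = pFun w) :
    Lp ℂ 2 (volume : Measure ℝ) →ₗᵢ[ℂ] WeightedL2 w where
  toFun y := ((memLp_transform_iff hw hw0 he y).2 (Lp.memLp y)).toLp _
  map_add' y y' := by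
    rw [← MemLp.toLp_add]
    refine MemLp.toLp_congr _ _ ((ae_weightMeasure_iff hw hw0).2 ?_)
    filter_upwards [(ae_comp_iff hw hw0 he).2 (Lp.coeFn_add y y')] with ξ h
    rw [h, Pi.add_apply, Pi.add_apply, mul_add]
  map_smul' c y := by
    rw [RingHom.id_apply, ← MemLp.toLp_const_smul]
    refine MemLp.toLp_congr _ _ ((ae_weightMeasure_iff hw hw0).2 ?_)
    filter_upwards [(ae_comp_iff hw hw0 he).2 (Lp.coeFn_smul c y)] with ξ h
    rw [h, Pi.smul_apply, Pi.smul_apply, smul_eq_mul, smul_eq_mul, mul_left_comm]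
  norm_map' y := by
    change ‖((memLp_transform_iff hw hw0 he y).2 (Lp.memLp y)).toLp _‖ = _
    rw [Lp.norm_toLp, eLpNorm_transform hw hw0 he, Lp.norm_def]

theorem transform_apply_ae (hw : Continuous w) (hw0 : ∀ ξ, w ξ ≠ 0) {e : ℝ ≃ₜ ℝ}
    (he : ⇑e = pFun w) (y : Lp ℂ 2 (volume : Measure ℝ)) :
    ∀ᵐ ξ, transform hw hw0 he y ξ = ((w ξ : ℂ))⁻¹ * y (e ξ) :=
  (ae_weightMeasure_iff hw hw0).1
    ((memLp_transform_iff hw hw0 he y).2 (Lp.memLp y)).coeFn_toLp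

theorem memLp_untransform (hw : Continuous w) (hw0 : ∀ ξ, w ξ ≠ 0) {e : ℝ ≃ₜ ℝ}
    (he : ⇑e = pFun w) {x : ℝ → ℂ} (hx : MemLp x 2 (weightMeasure w)) :
    MemLp (fun s => (w (e.symm s) : ℂ) * x (e.symm s)) 2 volume := by
  rw [← memLp_transform_iff hw hw0 he]
  refine (memLp_congr_ae (Eventually.of_forall fun ξ => ?_)).1 hx
  have : (w ξ : ℂ) ≠ 0 := by simpa using hw0 ξ
  simp [inv_mul_cancel_left₀ this]

theorem transform_untransform (hw : Continuous w) (hw0 : ∀ ξ, w ξ ≠ 0) {e : ℝ ≃ₜ ℝ}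
    (he : ⇑e = pFun w) {x : ℝ → ℂ} (hx : MemLp x 2 (weightMeasure w)) :
    transform hw hw0 he ((memLp_untransform hw hw0 he hx).toLp _) = hx.toLp x := by
  refine Lp.ext ((ae_weightMeasure_iff hw hw0).2 ?_)
  filter_upwards [transform_apply_ae hw hw0 he ((memLp_untransform hw hw0 he hx).toLp _),
    (ae_comp_iff hw hw0 he).2 (memLp_untransform hw hw0 he hx).coeFn_toLp,
    (ae_weightMeasure_iff hw hw0).1 hx.coeFn_toLp] with ξ h1 h2 h3
  have : (w ξ : ℂ) ≠ 0 := by simpa using hw0 ξ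
  rw [h1, h2, h3, e.symm_apply_apply, inv_mul_cancel_left₀ this]

/-- The unitary equivalence `L²(ℝ) ≃ L²_{|w|}(ℝ)` mapping `y` to `ξ ↦ w(ξ)⁻¹ y(p_w(ξ))`. -/
def transformEquiv (hw : Continuous w) (hw0 : ∀ ξ, w ξ ≠ 0) {e : ℝ ≃ₜ ℝ} (he : ⇑e = pFun w) :
    Lp ℂ 2 (volume : Measure ℝ) ≃ₗᵢ[ℂ] WeightedL2 w :=
  LinearIsometryEquiv.ofSurjective (transform hw hw0 he) fun x =>
    ⟨_, (transform_untransform hw hw0 he (Lp.memLp x)).trans (Lp.toLp_coeFn _ _)⟩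

theorem transformEquiv_apply_ae (hw : Continuous w) (hw0 : ∀ ξ, w ξ ≠ 0) {e : ℝ ≃ₜ ℝ}
    (he : ⇑e = pFun w) (y : Lp ℂ 2 (volume : Measure ℝ)) :
    ∀ᵐ ξ, transformEquiv hw hw0 he y ξ = ((w ξ : ℂ))⁻¹ * y (e ξ) :=
  transform_apply_ae hw hw0 he y

theorem transformEquiv_symm_toLp (hw : Continuous w) (hw0 : ∀ ξ, w ξ ≠ 0) {e : ℝ ≃ₜ ℝ}
    (he : ⇑e = pFun w) {x : ℝ → ℂ} (hx : MemLp x 2 (weightMeasure w)) :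
    (transformEquiv hw hw0 he).symm (hx.toLp x) = (memLp_untransform hw hw0 he hx).toLp _ :=
  (LinearIsometryEquiv.symm_apply_eq _).2 (transform_untransform hw hw0 he hx).symm

end Transform

/-! ### Graphs of the generator and of the transport operator -/

theorem mem_graph_generator_iff {E : Type*} [NormedAddCommGroup E] [NormedSpace ℂ E]
    (T : ℝ → E →L[ℂ] E) (x v : E) :
    (x, v) ∈ (generator T).graph ↔ Tendsto (diffQuot T x) (𝓝[≠] 0) (𝓝 v) := by
  rw [LinearPMap.mem_graph_iff]
  constructor
  · rintro ⟨y, rfl, rfl⟩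
    exact Classical.choose_spec y.2
  · intro h
    exact ⟨⟨x, v, h⟩, rfl,
      tendsto_nhds_unique (Classical.choose_spec (⟨v, h⟩ : ∃ y, Tendsto _ _ (𝓝 y))) h⟩

section Transport

variable {w : ℝ → ℝ}

theorem mem_graph_transportOp_iff (hw : Continuous w) (hw0 : ∀ ξ, w ξ ≠ 0)
    (x v : WeightedL2 w) :
    (x, v) ∈ (transportOp w hw hw0).graph ↔
      ∃ z, IsACRep w x z ∧ ∀ᵐ ξ, deriv z ξ = v ξ := by
  rw [LinearPMap.mem_graph_iff]
  constructor
  · rintro ⟨y, rfl, rfl⟩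
    have h := Classical.choose_spec y.2
    exact ⟨_, h, ((ae_weightMeasure_iff hw hw0).1 h.memLp.coeFn_toLp).mono fun ξ hξ => hξ.symm⟩
  · rintro ⟨z, hz, hv⟩
    refine ⟨⟨x, z, hz⟩, rfl, ?_⟩
    have h := Classical.choose_spec (⟨z, hz⟩ : ∃ z, IsACRep w x z)
    change h.memLp.toLp _ = v
    refine Lp.ext (h.memLp.coeFn_toLp.trans ?_)
    rw [h.unique hz]
    exact (ae_weightMeasure_iff hw hw0).2 hv

/-- Integrated form of (wx)' = v, free of derivatives and hence suited to substitution. -/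
theorem mem_graph_transportOp_iff_primitive (hw : Continuous w) (hw0 : ∀ ξ, w ξ ≠ 0)
    {x v : WeightedL2 w} (hv : LocallyIntegrable v volume) :
    (x, v) ∈ (transportOp w hw hw0).graph ↔
      ∃ c : ℂ, ∀ᵐ ξ, (w ξ : ℂ) * x ξ = c + ∫ ζ in (0 : ℝ)..ξ, v ζ := by
  rw [mem_graph_transportOp_iff]
  constructor
  · rintro ⟨z, hz, h⟩
    refine ⟨z 0, hz.ae_eq.mono fun ξ hξ => ?_⟩
    rw [← hξ, hz.locAC.eq_add_integral hv h]
  · rintro ⟨c, hc⟩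
    have hd := deriv_primitive_ae hv c
    exact ⟨_, ⟨LocAC.primitive hv c, hc.mono fun ξ hξ => hξ.symm,
      (Lp.memLp v).ae_eq ((ae_weightMeasure_iff hw hw0).2 (hd.mono fun ξ hξ => hξ.symm))⟩, hd⟩

variable {e : ℝ ≃ₜ ℝ}

theorem locallyIntegrable_transformEquiv (hw : Continuous w) (hw0 : ∀ ξ, w ξ ≠ 0)
    (he : ⇑e = pFun w) (u : Lp ℂ 2 (volume : Measure ℝ)) :
    LocallyIntegrable (transformEquiv hw hw0 he u) volume := by
  refine locallyIntegrable_iff.2 fun K hK => ?_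
  -- The image of K is compact, and the change of variables turns integrability of u there into that
  -- of |w⁻¹| (u ∘ p_w) on K.
  have h1 : IntegrableOn u (e '' K) :=
    (locallyIntegrable_coe u).integrableOn_isCompact (hK.image e.continuous)
  rw [he, integrableOn_image_iff_integrableOn_abs_deriv_smul hK.measurableSet
    (fun x _ => (hasDerivAt_pFun hw hw0 x).hasDerivWithinAt) (he ▸ e.injective.injOn), ← he] at h1
  refine h1.congr' (((Lp.aestronglyMeasurable _).mono_ac
    (volume_ac_weightMeasure hw hw0)).restrict) (ae_restrict_of_ae ?_)
  filter_upwards [transformEquiv_apply_ae hw hw0 he u] with ξ hξ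
  rw [hξ, norm_smul, norm_mul, norm_inv, Complex.norm_real, Real.norm_eq_abs, abs_abs, abs_inv,
    Real.norm_eq_abs]

theorem mem_graph_transportOp_transformEquiv_iff (hw : Continuous w) (hw0 : ∀ ξ, w ξ ≠ 0)
    (he : ⇑e = pFun w) (y u : Lp ℂ 2 (volume : Measure ℝ)) :
    (transformEquiv hw hw0 he y, transformEquiv hw hw0 he u) ∈ (transportOp w hw hw0).graph ↔
      ∃ c : ℂ, ∀ᵐ s, y s = c + ∫ r in (0 : ℝ)..s, u r := by
  rw [mem_graph_transportOp_iff_primitive hw hw0 (locallyIntegrable_transformEquiv hw hw0 he u)]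
  refine exists_congr fun c => ?_
  rw [← ae_comp_iff hw hw0 he (P := fun s => y s = c + ∫ r in (0 : ℝ)..s, u r)]
  refine eventually_congr ?_
  filter_upwards [transformEquiv_apply_ae hw hw0 he y] with ξ hξ
  have h0 : (w ξ : ℂ) ≠ 0 := by simpa using hw0 ξ
  rw [hξ, mul_inv_cancel_left₀ h0, intervalIntegral.integral_congr_ae
    ((transformEquiv_apply_ae hw hw0 he u).mono fun ζ hζ _ => hζ), he, integral_comp_pFun hw hw0]

/-! ### The weighted transport group -/

/-- The conjugate of the translation by `t` under the equivalence `L²(ℝ) ≃ L²_{|w|}(ℝ)`. -/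
def transportEquiv (hw : Continuous w) (hw0 : ∀ ξ, w ξ ≠ 0) (he : ⇑e = pFun w) (t : ℝ) :
    WeightedL2 w ≃ₗᵢ[ℂ] WeightedL2 w :=
  ((transformEquiv hw hw0 he).symm.trans (translationEquiv t)).trans (transformEquiv hw hw0 he)

/-- The group of weighted transport operators. -/
def transportGroup (hw : Continuous w) (hw0 : ∀ ξ, w ξ ≠ 0) (he : ⇑e = pFun w) (t : ℝ) :
    WeightedL2 w →L[ℂ] WeightedL2 w :=
  transportEquiv hw hw0 he t

theorem transportGroup_apply (hw : Continuous w) (hw0 : ∀ ξ, w ξ ≠ 0) (he : ⇑e = pFun w) (t : ℝ)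
    (x : WeightedL2 w) : transportGroup hw hw0 he t x =
      transformEquiv hw hw0 he (translation t ((transformEquiv hw hw0 he).symm x)) := rfl

theorem isC0Group_transportGroup (hw : Continuous w) (hw0 : ∀ ξ, w ξ ≠ 0) (he : ⇑e = pFun w) :
    IsC0Group (transportGroup hw hw0 he) where
  map_zero := by
    ext1 x
    rw [transportGroup_apply, translation_zero, LinearIsometryEquiv.apply_symm_apply]
    rfl
  map_add s t := by
    ext1 x
    rw [mul_apply_eq_comp, transportGroup_apply, transportGroup_apply,
      transportGroup_apply, LinearIsometryEquiv.symm_apply_apply, translation_add]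
  continuous_orbit x :=
    (transformEquiv hw hw0 he).continuous.comp (continuous_translation _)

theorem transportGroup_mem_unitary (hw : Continuous w) (hw0 : ∀ ξ, w ξ ≠ 0) (he : ⇑e = pFun w)
    (t : ℝ) : transportGroup hw hw0 he t ∈ unitary (WeightedL2 w →L[ℂ] WeightedL2 w) :=
  (Unitary.linearIsometryEquiv.symm (transportEquiv hw hw0 he t)).2

theorem generator_transportGroup (hw : Continuous w) (hw0 : ∀ ξ, w ξ ≠ 0) (he : ⇑e = pFun w) :
    generator (transportGroup hw hw0 he) = transportOp w hw hw0 := by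
  refine LinearPMap.eq_of_eq_graph (SetLike.ext ?_)
  rintro ⟨x, v⟩
  obtain ⟨y, rfl⟩ := (transformEquiv hw hw0 he).surjective x
  obtain ⟨u, rfl⟩ := (transformEquiv hw hw0 he).surjective v
  rw [mem_graph_generator_iff, mem_graph_transportOp_transformEquiv_iff]
  have e1 : diffQuot (transportGroup hw hw0 he) (transformEquiv hw hw0 he y) =
      transformEquiv hw hw0 he ∘ fun t : ℝ => ((t⁻¹ : ℝ) : ℂ) • (translation t y - y) := by
    funext t
    rw [diffQuot, transportGroup_apply, LinearIsometryEquiv.symm_apply_apply, Function.comp_apply,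
      map_smul, map_sub]
  -- An isometry preserves and reflects convergence, which reduces the claim to translations.
  rw [e1, ← (transformEquiv hw hw0 he).isometry.isEmbedding.isInducing.tendsto_nhds_iff]
  exact ⟨ae_eq_primitive_of_tendsto, fun ⟨_, h⟩ => tendsto_of_ae_eq_primitive h⟩

theorem add_muFun (he : ⇑e = pFun w) (ξ t : ℝ) : ξ + muFun w ξ t = e.symm (e ξ + t) := by
  rw [muFun, ← he, add_sub_cancel]
  refine e.injective ?_
  rw [e.apply_symm_apply]
  exact Function.rightInverse_invFun e.surjective _

theorem transportGroup_toLp_ae (hw : Continuous w) (hw0 : ∀ ξ, w ξ ≠ 0) (he : ⇑e = pFun w)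
    (t : ℝ) {x : ℝ → ℂ} (hx : MemLp x 2 (weightMeasure w)) :
    ∀ᵐ ξ : ℝ, transportGroup hw hw0 he t (hx.toLp x) ξ =
      ((w (ξ + muFun w ξ t) / w ξ : ℝ) : ℂ) * x (ξ + muFun w ξ t) := by
  rw [transportGroup_apply, transformEquiv_symm_toLp]
  set y := (memLp_untransform hw hw0 he hx).toLp _
  filter_upwards [transformEquiv_apply_ae hw hw0 he (translation t y),
    (ae_comp_iff hw hw0 he).2 (translation_apply_ae t y),
    (ae_comp_iff hw hw0 he).2
      (ae_add_right (memLp_untransform hw hw0 he hx).coeFn_toLp t)] with ξ h1 h2 h3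
  rw [h1, h2, h3, add_muFun he, Complex.ofReal_div, div_eq_inv_mul, mul_assoc]

end Transport

end WeightedTransport

end

open WeightedTransport in
theorem proposition4p1 (w : ℝ → ℝ) (hw : Continuous w) (hw0 : ∀ ξ, w ξ ≠ 0)
    (hneg : ¬ IntegrableOn (fun ξ => (w ξ)⁻¹) (Set.Iio 0))
    (hpos : ¬ IntegrableOn (fun ξ => (w ξ)⁻¹) (Set.Ioi 0)) :
    Function.Bijective (pFun w) ∧
    ∃ T : ℝ → WeightedL2 w →L[ℂ] WeightedL2 w,
      IsC0Group T ∧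
      (∀ t : ℝ, T t ∈ unitary (WeightedL2 w →L[ℂ] WeightedL2 w)) ∧
      generator T = transportOp w hw hw0 ∧
      ∀ (t : ℝ) (x : ℝ → ℂ) (hx : MemLp x 2 (weightMeasure w)),
        ∀ᵐ ξ : ℝ, T t (hx.toLp x) ξ =
          ((w (ξ + muFun w ξ t) / w ξ : ℝ) : ℂ) * x (ξ + muFun w ξ t) := by
  obtain ⟨e, he⟩ := exists_homeomorph hw hw0 hneg hpos
  exact ⟨he ▸ e.bijective, transportGroup hw hw0 he, isC0Group_transportGroup hw hw0 he,
    transportGroup_mem_unitary hw hw0 he, generator_transportGroup hw hw0 he,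
    fun t _ hx => transportGroup_toLp_ae hw hw0 he t hx⟩
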